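/- Let $k \ge 2$ be an integer. For a commutative ring $R$, let $R^k$ be the additive semigroup generated by all $k$-th powers of elements of $R$, and let the Waring number $g_R(k)$ be the smallest positive integer $g$ such that every element of $R^k$ is a sum of at most $g$ $k$-th powers of elements of $R$. For every integer $e \ge 1$, put $g_{2,e}(k) = g_R(k)$ for $R = \mathbb{Z}_2[\sqrt[e]{2}]$, where $\mathbb{Z}_2$ is the ring of $2$-adic integers. Then for every integer $e \ge 1$ (in particular, $g_{2,e}(2)$ exists) $$g_{2,e}(2) = \begin{cases} 4 & \text{if } e \text{ is odd},\\ 3 & \text{if } e \text{ is even}.\end{cases}$$ -/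

import Mathlib

/-- The ring `ℤ_p[p^{1/e}]`, presented as `ℤ_p[X] / (X ^ e - p)`. For `e ≥ 1` the polynomial
`X ^ e - p` is monic and Eisenstein at `p`, hence irreducible over `ℚ_p`, so this is the subring
of an algebraic closure of `ℚ_p` generated over `ℤ_p` by any `e`-th root of `p`. -/
abbrev PadicRootRing (p : ℕ) [Fact p.Prime] (e : ℕ) : Type :=
  AdjoinRoot (Polynomial.X ^ e - Polynomial.C (p : ℤ_[p]))

/-- The additive semigroup generated by all `k`-th powers of elements of `R`. -/
def powerSemigroup (R : Type*) [CommRing R] (k : ℕ) : AddSubsemigroup R :=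
  AddSubsemigroup.closure (Set.range fun x : R => x ^ k)

/-- `a` is a sum of at most `n` `k`-th powers of elements of `R`. -/
def IsSumOfAtMostPowers {R : Type*} [CommRing R] (k n : ℕ) (a : R) : Prop :=
  ∃ m : ℕ, m ≤ n ∧ ∃ x : Fin m → R, a = ∑ i, x i ^ k

/-- `g` is the Waring number `g_R(k)`: the smallest positive integer such that every element of
the additive semigroup generated by the `k`-th powers is a sum of at most `g` `k`-th powers. -/
def IsWaringNumber (R : Type*) [CommRing R] (k g : ℕ) : Prop :=
  IsLeast {n : ℕ | 0 < n ∧ ∀ a ∈ powerSemigroup R k, IsSumOfAtMostPowers k n a} g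

/-!
Put `R = ℤ₂[π]` with `π ^ e = 2`. Since `∑ xᵢ² ≡ (∑ xᵢ)²` modulo `2`, every sum of squares in `R`
has the form `a ^ 2 + 2 * b`. The ring `R` is `π`-adically complete with residue field `𝔽₂`, so
`y ^ 2 + β * y + γ` has a root as soon as `β ≡ 1` and `γ ≡ 0` modulo `π`
(`IsDyadicUniformizer.exists_quadratic_root`), and this is the only source of representations.
Squares are produced with a prescribed sum `c`, where `c ^ 2 ≡ a ^ 2` modulo `2`. For instance
`x ^ 2 + (c - x) ^ 2 = c ^ 2 + 2 * (x ^ 2 - c * x)`, so that representing `a ^ 2 + 2 * b` becomes a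
quadratic equation in one of the summands.

* If `e = 2 * f`, then `c = a + π ^ f * s` satisfies `c ^ 2 = a ^ 2 + 2 * (a * π ^ f * s + s ^ 2)`,
  and a suitable `s` makes the quadratic equation for three squares solvable for all `a`, `b`
  (`exists_three_sq`). On the other hand `2 * (1 + π)` is not a sum of two squares: if
  `x ^ 2 + y ^ 2` is divisible by `2`, then `x + y = π ^ f * t`, and `1 + π` would equal
  `x ^ 2 + t ^ 2 - π ^ f * x * t`, whose unit values are `1` modulo `π ^ 2`
  (`two_mul_one_add_ne_sum_two_sq`).
* If `e` is odd, four squares suffice when `a` or `b` is a unit; otherwise `a ^ 2 + 2 * b` is `π ^ 2`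
  times an element of the same form, and one descends (`exists_four_sq`). In particular `-1`, which
  is `1 ^ 2 + 2 * (-1)`, is a sum of four squares. It is not a sum of three: a sum of four squares
  is anisotropic over `ℚ₂`, and by Springer's argument on polynomials of odd degree it stays so
  over `ℚ₂[X] / (X ^ e - 2)` (`not_dvd_sum_sq_of_odd_natDegree`).
-/

open Polynomial

/-! ### Sums of squares modulo a polynomial of odd degree -/

section Springer

variable {F ι : Type*} [Field F] [Fintype ι]

/-- Over a field where the sum of squares is anisotropic, leading terms of a sum of squares of
polynomials cannot cancel, so its degree is even. -/
theorem natDegree_sum_sq_of_anisotropic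
    (hF : ∀ a : ι → F, ∑ i, a i ^ 2 = 0 → ∀ i, a i = 0) (f : ι → F[X]) {i₀ : ι} (h₀ : f i₀ ≠ 0) :
    (∑ i, f i ^ 2) ≠ 0 ∧ ∃ i, (∑ i, f i ^ 2).natDegree = 2 * (f i).natDegree := by
  obtain ⟨i, -, hi⟩ := Finset.exists_max_image Finset.univ (fun i => (f i).degree)
    ⟨i₀, Finset.mem_univ _⟩
  have hfi : f i ≠ 0 := by
    intro h
    have := hi i₀ (Finset.mem_univ _)
    rw [h, degree_zero, le_bot_iff, degree_eq_bot] at this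
    exact h₀ this
  have hle : ∀ j, (f j).natDegree ≤ (f i).natDegree := fun j =>
    natDegree_le_natDegree (hi j (Finset.mem_univ _))
  have hcoeff : (∑ j, f j ^ 2).coeff (2 * (f i).natDegree) ≠ 0 := by
    rw [finsetSum_coeff]
    simp_rw [coeff_pow_of_natDegree_le (hle _)]
    intro h
    exact hfi (leadingCoeff_eq_zero.mp (hF _ h i))
  refine ⟨fun h => hcoeff (by rw [h, coeff_zero]), i, le_antisymm ?_ (le_natDegree_of_ne_zero hcoeff)⟩
  refine natDegree_sum_le_of_forall_le _ _ fun j _ => ?_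
  exact natDegree_pow_le.trans (Nat.mul_le_mul_left 2 (hle j))

/-- A form of Springer's theorem: an anisotropic sum of squares has no zero with a coordinate `1`
modulo a polynomial `p` of odd degree. After reduction of the `f i` modulo `p`, the cofactor of `p`
in the sum of squares again has odd degree, which is smaller than that of `p`. -/
theorem not_dvd_sum_sq_of_odd_natDegree
    (hF : ∀ a : ι → F, ∑ i, a i ^ 2 = 0 → ∀ i, a i = 0) (p : F[X]) (hp : Odd p.natDegree)
    (f : ι → F[X]) (i₀ : ι) (h₀ : f i₀ = 1) : ¬ p ∣ ∑ i, f i ^ 2 := by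
  induction hn : p.natDegree using Nat.strong_induction_on generalizing p f with
  | _ n ih =>
  intro hdvd
  have hp0 : 0 < p.natDegree := hp.pos
  have hr₀ : f i₀ % p = 1 := by
    rw [h₀, mod_eq_self_iff (ne_zero_of_natDegree_gt hp0), degree_one]
    exact natDegree_pos_iff_degree_pos.mp hp0
  have hr : p ∣ ∑ i, (f i % p) ^ 2 := by
    have h : p ∣ ∑ i, (f i ^ 2 - (f i % p) ^ 2) := Finset.dvd_sum fun i _ => by
      rw [sq_sub_sq]
      exact Dvd.dvd.mul_left
        ⟨f i / p, sub_eq_iff_eq_add.mpr (EuclideanDomain.div_add_mod (f i) p).symm⟩ _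
    rw [Finset.sum_sub_distrib] at h
    exact (dvd_sub_right hdvd).mp h
  obtain ⟨hS, i, hi⟩ := natDegree_sum_sq_of_anisotropic hF (fun i => f i % p) (i₀ := i₀)
    (by simp [hr₀])
  have hlt : (f i % p).natDegree < p.natDegree := natDegree_mod_lt _ hp0.ne'
  obtain ⟨q, hq⟩ := hr
  have hmul : (p * q).natDegree = p.natDegree + q.natDegree :=
    natDegree_mul (left_ne_zero_of_mul (hq ▸ hS)) (right_ne_zero_of_mul (hq ▸ hS))
  rw [hq, hmul] at hi
  obtain ⟨k, hk⟩ := hp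
  exact ih q.natDegree (by omega) q ⟨(f i % p).natDegree - k - 1, by omega⟩ (fun i => f i % p) hr₀
    rfl ⟨p, by rw [hq, mul_comm]⟩

end Springer

/-! ### Minus one is not a sum of three squares when `e` is odd -/

theorem padic_two_sum_four_sq_anisotropic (a : Fin 4 → ℚ_[2]) (ha : ∑ i, a i ^ 2 = 0) (i : Fin 4) :
    a i = 0 := by
  by_contra hne
  obtain ⟨m, -, hm⟩ := Finset.exists_max_image Finset.univ (fun i => ‖a i‖) ⟨i, Finset.mem_univ _⟩
  have ham : a m ≠ 0 := fun h => hne (by simpa [h] using hm i (Finset.mem_univ _))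
  let c : Fin 4 → ℤ_[2] := fun j => ⟨a j / a m, by
    rw [norm_div]
    exact div_le_one_of_le₀ (hm j (Finset.mem_univ _)) (norm_nonneg _)⟩
  have hcm : c m = 1 := Subtype.ext (div_self ham)
  have hc : ∑ j, c j ^ 2 = 0 := by
    apply Subtype.ext
    rw [PadicInt.coe_sum, PadicInt.coe_zero]
    change ∑ j, (a j / a m) ^ 2 = 0
    simp only [div_pow, ← Finset.sum_div, ha, zero_div]
  have h8 : ∀ x y z : ZMod (2 ^ 3), 1 + x ^ 2 + y ^ 2 + z ^ 2 ≠ 0 := by decide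
  have hc8 := congrArg (PadicInt.toZModPow (p := 2) 3) hc
  have hcm8 := congrArg (PadicInt.toZModPow (p := 2) 3) hcm
  simp only [Fin.sum_univ_four, map_add, map_pow, map_zero, map_one] at hc8 hcm8
  generalize PadicInt.toZModPow (p := 2) 3 = φ at hc8 hcm8
  fin_cases m <;> simp only [Fin.zero_eta, Fin.mk_one, Fin.reduceFinMk] at hcm8 <;>
    rw [hcm8] at hc8
  · exact h8 (φ (c 1)) (φ (c 2)) (φ (c 3)) (by linear_combination hc8)
  · exact h8 (φ (c 0)) (φ (c 2)) (φ (c 3)) (by linear_combination hc8)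
  · exact h8 (φ (c 0)) (φ (c 1)) (φ (c 3)) (by linear_combination hc8)
  · exact h8 (φ (c 0)) (φ (c 1)) (φ (c 2)) (by linear_combination hc8)

theorem neg_one_ne_sum_three_sq {e : ℕ} (he : Odd e) (x y z : PadicRootRing 2 e) :
    -1 ≠ x ^ 2 + y ^ 2 + z ^ 2 := by
  intro h
  obtain ⟨f, rfl⟩ := AdjoinRoot.mk_surjective x
  obtain ⟨g, rfl⟩ := AdjoinRoot.mk_surjective y
  obtain ⟨k, rfl⟩ := AdjoinRoot.mk_surjective z
  have hdvd : (X ^ e - C ((2 : ℕ) : ℤ_[2])) ∣ 1 + f ^ 2 + g ^ 2 + k ^ 2 := by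
    rw [← AdjoinRoot.mk_eq_zero]
    simp only [map_add, map_pow, map_one]
    linear_combination -h
  have hmap := Polynomial.map_dvd (algebraMap ℤ_[2] ℚ_[2]) hdvd
  refine not_dvd_sum_sq_of_odd_natDegree padic_two_sum_four_sq_anisotropic _ ?_
    (fun i => (![1, f, g, k] i).map (algebraMap ℤ_[2] ℚ_[2])) 0 (by simp) (hmap.trans ?_)
  · rwa [(monic_X_pow_sub_C _ he.pos.ne').natDegree_map, natDegree_X_pow_sub_C]
  · simp [Fin.sum_univ_four]

/-! ### Sums of squares in a complete ring with residue field of two elements -/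

/-- The properties of `π ∈ R = ℤ₂[π]`, `π ^ e = 2`, used to study sums of squares: `π` is a
non-zero-divisor with `R / π = 𝔽₂`, and `R` is `π`-adically separated and complete.
Completeness is stated for sequences whose `n`-th increment is divisible by `π ^ n`. -/
structure IsDyadicUniformizer {R : Type*} [CommRing R] (π : R) (e : ℕ) : Prop where
  pos : 1 ≤ e
  pow_eq : π ^ e = 2
  eq_zero_of_mul : ∀ x, π * x = 0 → x = 0
  residue : ∀ x, π ∣ x ∨ π ∣ x - 1
  not_dvd_one : ¬ π ∣ 1
  eq_zero_of_forall_dvd : ∀ x, (∀ n, π ^ n ∣ x) → x = 0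
  exists_limit : ∀ f : ℕ → R, (∀ n, π ^ n ∣ f (n + 1) - f n) → ∃ L, ∀ n, π ^ n ∣ L - f n

namespace IsDyadicUniformizer

variable {R : Type*} [CommRing R] {π : R} {e : ℕ}

theorem dvd_two (h : IsDyadicUniformizer π e) : π ∣ 2 :=
  h.pow_eq ▸ dvd_pow_self π (Nat.one_le_iff_ne_zero.mp h.pos)

theorem dvd_sq_sub_self (h : IsDyadicUniformizer π e) (x : R) : π ∣ x ^ 2 - x := by
  rw [show x ^ 2 - x = x * (x - 1) by ring]
  exact (h.residue x).elim (fun h => h.mul_right _) (fun h => h.mul_left _)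

theorem cancel_pow (h : IsDyadicUniformizer π e) (n : ℕ) {x y : R} (hxy : π ^ n * x = π ^ n * y) :
    x = y := by
  induction n with
  | zero => simpa using hxy
  | succ n ih =>
    refine ih (sub_eq_zero.mp (h.eq_zero_of_mul _ ?_))
    linear_combination hxy

theorem cancel_two (h : IsDyadicUniformizer π e) {x y : R} (hxy : 2 * x = 2 * y) : x = y :=
  h.cancel_pow e (by rwa [h.pow_eq])

theorem dvd_of_dvd_sq (h : IsDyadicUniformizer π e) {x : R} (hx : π ∣ x ^ 2) : π ∣ x := by
  simpa using dvd_sub hx (h.dvd_sq_sub_self x)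

theorem pow_dvd_of_pow_dvd_sq (h : IsDyadicUniformizer π e) (n : ℕ) {x : R}
    (hx : π ^ (2 * n) ∣ x ^ 2) : π ^ n ∣ x := by
  induction n generalizing x with
  | zero => simp
  | succ n ih =>
    obtain ⟨y, rfl⟩ := h.dvd_of_dvd_sq ((dvd_pow_self π (by omega)).trans hx)
    obtain ⟨z, hz⟩ := hx
    rw [pow_succ']
    refine mul_dvd_mul_left π (ih ⟨z, h.cancel_pow 2 ?_⟩)
    linear_combination hz

/-- Hensel's lemma for a monic quadratic with unit linear coefficient, by iterating
`t ↦ t - (t ^ 2 + β * t + γ)` from `0`; this converges because the derivative is `1` modulo `π`. -/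
theorem exists_quadratic_root (h : IsDyadicUniformizer π e) {β γ : R} (hβ : π ∣ β - 1)
    (hγ : π ∣ γ) : ∃ y, y ^ 2 + β * y + γ = 0 := by
  let y : ℕ → R := fun n => Nat.rec 0 (fun _ t => t - (t ^ 2 + β * t + γ)) n
  have hy : ∀ n, y (n + 1) = y n - (y n ^ 2 + β * y n + γ) := fun n => rfl
  have hval : ∀ n, π ^ (n + 1) ∣ y n ^ 2 + β * y n + γ := by
    intro n
    induction n with
    | zero => simpa [y] using hγ
    | succ n ih =>
      have hstep : y (n + 1) ^ 2 + β * y (n + 1) + γ = (y n ^ 2 + β * y n + γ) *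
          ((y n ^ 2 + β * y n + γ) - (β - 1) - 2 * y n) := by
        rw [hy]; ring
      rw [hstep, pow_succ]
      exact mul_dvd_mul ih (dvd_sub (dvd_sub ((dvd_pow_self π n.succ_ne_zero).trans ih) hβ)
        (h.dvd_two.mul_right _))
  obtain ⟨L, hL⟩ := h.exists_limit y fun n => by
    rw [hy, sub_sub_cancel_left, dvd_neg]
    exact (pow_dvd_pow π n.le_succ).trans (hval n)
  refine ⟨L, h.eq_zero_of_forall_dvd _ fun n => ?_⟩
  rw [show L ^ 2 + β * L + γ = (L - y n) * (L + y n + β) + (y n ^ 2 + β * y n + γ) by ring]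
  exact dvd_add ((hL n).mul_right _) ((pow_dvd_pow π n.le_succ).trans (hval n))

theorem exists_three_sq (h : IsDyadicUniformizer π e) (he : Even e) (a b : R) :
    ∃ x y z, a ^ 2 + 2 * b = x ^ 2 + y ^ 2 + z ^ 2 := by
  obtain ⟨f, hf⟩ := he
  have hπ2 : π ^ f * π ^ f = 2 := by rw [← pow_add, ← hf, h.pow_eq]
  have hπf : π ∣ π ^ f := dvd_pow_self π (by have := h.pos; omega)
  rcases h.residue a with ha | ha
  -- The squares are `1`, `y` and `c - 1 - y` with `c = a + π ^ f * s`; the constant term of the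
  -- equation for `y` is `s ^ 2 + 1 - b` modulo `π`, hence `s = b + 1`.
  · obtain ⟨y, hy⟩ := h.exists_quadratic_root (β := 1 - (a + π ^ f * (b + 1)))
      (γ := (b + 1) ^ 2 + a * π ^ f * (b + 1) + 1 - (a + π ^ f * (b + 1)) - b)
      (by
        rw [sub_sub_cancel_left, dvd_neg]
        exact dvd_add ha (hπf.mul_right _))
      (by
        rw [show (b + 1) ^ 2 + a * π ^ f * (b + 1) + 1 - (a + π ^ f * (b + 1)) - b =
          (b ^ 2 - b) + 2 * (b + 1) + a * (π ^ f * (b + 1) - 1) - π ^ f * (b + 1) by ring]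
        exact dvd_sub (dvd_add (dvd_add (h.dvd_sq_sub_self b) (h.dvd_two.mul_right _))
          (ha.mul_right _)) (hπf.mul_right _))
    refine ⟨1, y, a + π ^ f * (b + 1) - 1 - y, ?_⟩
    linear_combination (-2) * hy - (b + 1) ^ 2 * hπ2
  -- Two squares `x` and `c - x` suffice here, with `c = a + π ^ f * b` a unit.
  · obtain ⟨x, hx⟩ := h.exists_quadratic_root (β := -(a + π ^ f * b))
      (γ := b ^ 2 + a * π ^ f * b - b)
      (by
        rw [show -(a + π ^ f * b) - 1 = -(a - 1) - π ^ f * b - 2 by ring]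
        exact dvd_sub (dvd_sub ((dvd_neg).mpr ha) (hπf.mul_right _)) h.dvd_two)
      (by
        rw [show b ^ 2 + a * π ^ f * b - b = (b ^ 2 - b) + π ^ f * (a * b) by ring]
        exact dvd_add (h.dvd_sq_sub_self b) (hπf.mul_right _))
    refine ⟨x, a + π ^ f * b - x, 0, ?_⟩
    linear_combination (-2) * hx - b ^ 2 * hπ2

theorem two_mul_one_add_ne_sum_two_sq (h : IsDyadicUniformizer π e) (he : Even e) (x y : R) :
    2 * (1 + π) ≠ x ^ 2 + y ^ 2 := by
  intro hxy
  obtain ⟨f, hf⟩ := he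
  have hπ2 : π ^ f * π ^ f = 2 := by rw [← pow_add, ← hf, h.pow_eq]
  obtain ⟨ρ, hρ⟩ : π ∣ π ^ f := dvd_pow_self π (by have := h.pos; omega)
  obtain ⟨τ, hτ⟩ := h.dvd_two
  obtain ⟨t, ht⟩ : π ^ f ∣ x + y := h.pow_dvd_of_pow_dvd_sq f
    ⟨1 + π + x * y, by rw [two_mul, ← hf, h.pow_eq]; linear_combination -hxy⟩
  have key : 1 + π = x ^ 2 + t ^ 2 - π ^ f * (x * t) := by
    apply h.cancel_two
    rw [eq_sub_of_add_eq' ht] at hxy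
    linear_combination hxy + t ^ 2 * hπ2
  -- If `π ∣ x`, then `t` is a unit, and `x ^ 2 + t ^ 2 - π ^ f * x * t` is `1` modulo `π ^ 2`.
  have nonunit : ∀ x t : R, 1 + π = x ^ 2 + t ^ 2 - π ^ f * (x * t) → ¬ π ∣ x := by
    rintro _ t hk ⟨x, rfl⟩
    rcases h.residue t with ⟨t, rfl⟩ | ⟨s, hs⟩
    · exact h.not_dvd_one ⟨π * x ^ 2 + π * t ^ 2 - π ^ f * (π * (x * t)) - 1, by
        linear_combination hk⟩
    · obtain rfl : t = 1 + π * s := by linear_combination hs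
      refine h.not_dvd_one ⟨x ^ 2 + s ^ 2 + τ * s - ρ * x * (1 + π * s), h.cancel_pow 1 ?_⟩
      linear_combination hk + π * s * hτ - (π * x * (1 + π * s)) * hρ
  rcases h.residue x with hx | ⟨u, hu⟩
  · exact nonunit x t key hx
  rcases h.residue t with ht' | ⟨v, hv⟩
  · exact nonunit t x (by linear_combination key) ht'
  -- If `x` and `t` are both units, then `x ^ 2 + t ^ 2 - π ^ f * x * t` is divisible by `π`.
  · obtain rfl : x = 1 + π * u := by linear_combination hu
    obtain rfl : t = 1 + π * v := by linear_combination hv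
    refine h.not_dvd_one ⟨τ + 2 * u + 2 * v + π * u ^ 2 + π * v ^ 2
      - ρ * ((1 + π * u) * (1 + π * v)) - 1, ?_⟩
    linear_combination key + hτ - ((1 + π * u) * (1 + π * v)) * hρ

/-- For a suitable choice of residues of three of the squares, with the sum of all four equal to `a`,
the equation for one of them is quadratic with unit linear coefficient. -/
theorem exists_four_sq_of_not_dvd (h : IsDyadicUniformizer π e) {a b : R}
    (hab : ¬ (π ∣ a ∧ π ∣ b)) :
    ∃ x y z w, a ^ 2 + 2 * b = x ^ 2 + y ^ 2 + z ^ 2 + w ^ 2 := by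
  rcases h.residue a with ha | ha
  · have hb : π ∣ b - 1 := (h.residue b).resolve_left fun hb => hab ⟨ha, hb⟩
    obtain ⟨y, hy⟩ := h.exists_quadratic_root (β := 1 - a) (γ := 1 - a - b)
      (by simpa using ha)
      (by
        rw [show 1 - a - b = -a - (b - 1) by ring]
        exact dvd_sub ((dvd_neg).mpr ha) hb)
    exact ⟨1, y, 0, a - 1 - y, by linear_combination (-2) * hy⟩
  rcases h.residue b with hb | hb
  · obtain ⟨x, hx⟩ := h.exists_quadratic_root (β := -a) (γ := -b)
      (by
        rw [show -a - 1 = -(a - 1) - 2 by ring]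
        exact dvd_sub ((dvd_neg).mpr ha) h.dvd_two)
      ((dvd_neg).mpr hb)
    exact ⟨x, a - x, 0, 0, by linear_combination (-2) * hx⟩
  · obtain ⟨z, hz⟩ := h.exists_quadratic_root (β := 2 - a) (γ := 3 - 2 * a - b)
      (by
        rw [show 2 - a - 1 = -(a - 1) by ring]
        exact (dvd_neg).mpr ha)
      (by
        rw [show 3 - 2 * a - b = 2 * (1 - a) - (b - 1) by ring]
        exact dvd_sub (h.dvd_two.mul_right _) hb)
    exact ⟨1, 1, z, a - 2 - z, by linear_combination (-2) * hz⟩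

/-- With `a = π * a'`, `b = π * b'` and `e = 2 * f + 1`, replacing `a` by `a + π ^ (f + 1) * b'`
changes `a ^ 2` by an element of `2 * R` that makes the remaining `b` divisible by `π ^ 2`. -/
theorem exists_descent (h : IsDyadicUniformizer π e) (he : Odd e) {a b : R}
    (ha : π ∣ a) (hb : π ∣ b) : ∃ c d, a ^ 2 + 2 * b = π ^ 2 * (c ^ 2 + 2 * d) := by
  obtain ⟨f, hf⟩ := he
  have hπ2 : π * (π ^ f) ^ 2 = 2 := by rw [← h.pow_eq, hf]; ring
  obtain ⟨a, rfl⟩ := ha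
  obtain ⟨b, rfl⟩ := hb
  obtain ⟨t, ht⟩ := h.dvd_sq_sub_self b
  refine ⟨a + π ^ f * b, -t - π ^ f * a * b, ?_⟩
  linear_combination (-2 * π) * ht - π * b ^ 2 * hπ2

theorem exists_four_sq (h : IsDyadicUniformizer π e) (he : Odd e) (a b : R) :
    ∃ x y z w, a ^ 2 + 2 * b = x ^ 2 + y ^ 2 + z ^ 2 + w ^ 2 := by
  by_cases h0 : a ^ 2 + 2 * b = 0
  · exact ⟨0, 0, 0, 0, by simp [h0]⟩
  obtain ⟨n, hn⟩ : ∃ n, ¬ π ^ n ∣ a ^ 2 + 2 * b := by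
    by_contra! hall
    exact h0 (h.eq_zero_of_forall_dvd _ hall)
  clear h0
  induction n generalizing a b with
  | zero => simp at hn
  | succ n ih =>
    by_cases hab : π ∣ a ∧ π ∣ b
    · obtain ⟨c, d, hcd⟩ := h.exists_descent he hab.1 hab.2
      obtain ⟨x, y, z, w, hxyz⟩ := ih c d fun hdvd => hn (by
        rw [hcd, pow_succ, mul_comm]
        exact mul_dvd_mul (dvd_pow_self π two_ne_zero) hdvd)
      exact ⟨π * x, π * y, π * z, π * w, by rw [hcd, hxyz]; ring⟩
    · exact h.exists_four_sq_of_not_dvd hab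

end IsDyadicUniformizer

/-! ### Completeness of finite free algebras over the `p`-adic integers -/

section AdicBasis

theorem PadicInt.eq_zero_of_forall_pow_dvd {p : ℕ} [Fact p.Prime] (x : ℤ_[p])
    (hx : ∀ n, (p : ℤ_[p]) ^ n ∣ x) : x = 0 := by
  refine IsHausdorff.haus (I := IsLocalRing.maximalIdeal ℤ_[p]) inferInstance x fun n => ?_
  rw [SModEq.zero, PadicInt.maximalIdeal_eq_span_p, Ideal.span_singleton_pow, smul_eq_mul,
    Ideal.mul_top, Ideal.mem_span_singleton]
  exact hx n

theorem pow_dvd_sub_of_le {R : Type*} [CommRing R] {π : R} {f : ℕ → R}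
    (hf : ∀ n, π ^ n ∣ f (n + 1) - f n) {m n : ℕ} (hmn : m ≤ n) : π ^ m ∣ f n - f m := by
  induction n, hmn using Nat.le_induction with
  | base => simp
  | succ n hmn ih =>
    rw [← sub_add_sub_cancel]
    exact dvd_add ((pow_dvd_pow π hmn).trans (hf n)) ih

theorem PadicInt.exists_limit {p : ℕ} [Fact p.Prime] (f : ℕ → ℤ_[p])
    (hf : ∀ n, (p : ℤ_[p]) ^ n ∣ f (n + 1) - f n) : ∃ L, ∀ n, (p : ℤ_[p]) ^ n ∣ L - f n := by
  have key : ∀ (n : ℕ) (x y : ℤ_[p]), x ≡ y [SMOD (IsLocalRing.maximalIdeal ℤ_[p] ^ n • ⊤ :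
      Submodule ℤ_[p] ℤ_[p])] ↔ (p : ℤ_[p]) ^ n ∣ y - x := by
    intro n x y
    rw [SModEq.comm, SModEq.sub_mem, PadicInt.maximalIdeal_eq_span_p, Ideal.span_singleton_pow,
      smul_eq_mul, Ideal.mul_top, Ideal.mem_span_singleton]
  obtain ⟨L, hL⟩ := IsPrecomplete.prec' (I := IsLocalRing.maximalIdeal ℤ_[p]) f
    fun {m n} hmn => (key m _ _).mpr (pow_dvd_sub_of_le hf hmn)
  exact ⟨L, fun n => (key n _ _).mp (hL n)⟩

variable {p : ℕ} [Fact p.Prime] {R ι : Type*} [CommRing R] [Algebra ℤ_[p] R]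

/-- Divisibility by `p ^ n` in a free algebra is coordinatewise, which reduces separatedness and
completeness to `ℤ_[p]`. -/
theorem dvd_iff_forall_dvd_repr [Fintype ι] (b : Module.Basis ι ℤ_[p] R) (n : ℕ) (x : R) :
    (p : R) ^ n ∣ x ↔ ∀ i, (p : ℤ_[p]) ^ n ∣ b.repr x i := by
  have hsmul : ∀ y : R, (p : R) ^ n * y = ((p : ℤ_[p]) ^ n) • y := fun y => by
    rw [Algebra.smul_def, map_pow, map_natCast]
  constructor
  · rintro ⟨y, rfl⟩ i
    rw [hsmul, map_smul, Finsupp.smul_apply, smul_eq_mul]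
    exact dvd_mul_right _ _
  · intro hx
    choose c hc using hx
    refine ⟨∑ i, c i • b i, ?_⟩
    rw [hsmul, Finset.smul_sum]
    conv_lhs => rw [← b.sum_repr x]
    exact Finset.sum_congr rfl fun i _ => by rw [hc, mul_smul]

theorem eq_zero_of_forall_pow_dvd [Fintype ι] (b : Module.Basis ι ℤ_[p] R) (x : R)
    (hx : ∀ n, (p : R) ^ n ∣ x) : x = 0 :=
  b.ext_elem fun i => by
    rw [map_zero, Finsupp.zero_apply]
    exact PadicInt.eq_zero_of_forall_pow_dvd _ fun n => (dvd_iff_forall_dvd_repr b n x).mp (hx n) i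

theorem exists_limit_of_basis [Fintype ι] (b : Module.Basis ι ℤ_[p] R) (f : ℕ → R)
    (hf : ∀ n, (p : R) ^ n ∣ f (n + 1) - f n) : ∃ L, ∀ n, (p : R) ^ n ∣ L - f n := by
  have hi : ∀ i, ∃ L, ∀ n, (p : ℤ_[p]) ^ n ∣ L - b.repr (f n) i := fun i =>
    PadicInt.exists_limit (fun n => b.repr (f n) i) fun n => by
      simpa using (dvd_iff_forall_dvd_repr b n _).mp (hf n) i
  choose L hL using hi
  refine ⟨∑ i, L i • b i, fun n => (dvd_iff_forall_dvd_repr b n _).mpr fun i => ?_⟩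
  rw [map_sub, Finsupp.sub_apply, b.repr_sum_self]
  exact hL i n

end AdicBasis

/-! ### The ring obtained by adjoining a root of two -/

theorem isDyadicUniformizer_root {e : ℕ} (he : 1 ≤ e) :
    IsDyadicUniformizer
      (AdjoinRoot.root (X ^ e - C ((2 : ℕ) : ℤ_[2])) : PadicRootRing 2 e) e := by
  set P : ℤ_[2][X] := X ^ e - C ((2 : ℕ) : ℤ_[2]) with hP
  have he0 : e ≠ 0 := by omega
  have hmonic : P.Monic := monic_X_pow_sub_C _ he0
  let b := (AdjoinRoot.powerBasis' hmonic).basis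
  set π : AdjoinRoot P := AdjoinRoot.root P
  have hpow : π ^ e = 2 := by
    have := AdjoinRoot.eval₂_root P
    simp only [hP, eval₂_sub, eval₂_pow, eval₂_X, map_natCast, eval₂_natCast] at this
    exact_mod_cast sub_eq_zero.mp this
  have hpow' : ∀ n, π ^ (e * n) = ((2 : ℕ) : AdjoinRoot P) ^ n := fun n => by
    rw [pow_mul, hpow, Nat.cast_ofNat]
  have hle : ∀ n, n ≤ e * n := fun n => Nat.le_mul_of_pos_left n he
  -- Reduction modulo `π`, which shows that `π` is not a unit.
  let φ : AdjoinRoot P →+* ZMod 2 := AdjoinRoot.lift PadicInt.toZMod 0 (by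
    simpa [hP, he0] using (map_ofNat PadicInt.toZMod 2).trans (by decide))
  have hφ : φ π = 0 := AdjoinRoot.lift_root _
  refine ⟨he, hpow, fun x hx => ?_, fun x => ?_, fun ⟨t, ht⟩ => ?_, fun x hx => ?_, fun f hf => ?_⟩
  · have h2 : (2 : ℤ_[2]) • x = 0 := by
      rw [Algebra.smul_def, map_ofNat, ← hpow, ← Nat.sub_add_cancel he, pow_succ, mul_assoc, hx,
        mul_zero]
    refine b.ext_elem fun i => ?_
    have := congrArg (fun y => b.repr y i) h2
    simpa using this
  · obtain ⟨g, rfl⟩ := AdjoinRoot.mk_surjective x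
    have hg : AdjoinRoot.mk P g = π * AdjoinRoot.mk P g.divX + AdjoinRoot.of P (g.coeff 0) := by
      have := congrArg (AdjoinRoot.mk P) (X_mul_divX_add g)
      rw [map_add, map_mul, AdjoinRoot.mk_X, AdjoinRoot.mk_C] at this
      exact this.symm
    have h2 : ∀ c : ℤ_[2], c ∈ IsLocalRing.maximalIdeal ℤ_[2] → π ∣ AdjoinRoot.of P c := by
      intro c hc
      rw [PadicInt.maximalIdeal_eq_span_p, Ideal.mem_span_singleton] at hc
      obtain ⟨d, rfl⟩ := hc
      rw [map_mul, map_natCast, Nat.cast_ofNat, ← hpow]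
      exact (dvd_pow_self π he0).mul_right _
    have hc := PadicInt.toZMod_spec (p := 2) (g.coeff 0)
    rcases (show ∀ z : ZMod 2, z = 0 ∨ z = 1 by decide) (PadicInt.toZMod (g.coeff 0)) with hz | hz
    · left
      rw [hz, ZMod.cast_zero, sub_zero] at hc
      rw [hg]
      exact dvd_add (dvd_mul_right _ _) (h2 _ hc)
    · right
      rw [hz, ZMod.cast_eq_val, ZMod.val_one, Nat.cast_one] at hc
      have := h2 _ hc
      rw [map_sub, map_one] at this
      rw [hg, add_sub_assoc]
      exact dvd_add (dvd_mul_right _ _) this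
  · have := congrArg φ ht
    rw [map_one, map_mul, hφ, zero_mul] at this
    exact one_ne_zero this
  · exact eq_zero_of_forall_pow_dvd b x fun n => hpow' n ▸ hx (e * n)
  · obtain ⟨L, hL⟩ := exists_limit_of_basis b (fun n => f (e * n)) fun n => by
      rw [← hpow']
      exact pow_dvd_sub_of_le hf (Nat.mul_le_mul_left e n.le_succ)
    refine ⟨L, fun n => ?_⟩
    rw [← sub_add_sub_cancel L (f (e * n)) (f n)]
    exact dvd_add ((pow_dvd_pow π (hle n)).trans (hpow' n ▸ hL n)) (pow_dvd_sub_of_le hf (hle n))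

/-! ### Waring numbers -/

section Waring

variable {R : Type*} [CommRing R]

theorem exists_eq_sq_add_two_mul {N : R} (hN : N ∈ powerSemigroup R 2) :
    ∃ a b, N = a ^ 2 + 2 * b := by
  induction hN using AddSubsemigroup.closure_induction with
  | mem x hx =>
    obtain ⟨y, rfl⟩ := hx
    exact ⟨y, 0, by simp⟩
  | add x y _ _ hx hy =>
    obtain ⟨a, b, rfl⟩ := hx
    obtain ⟨c, d, rfl⟩ := hy
    exact ⟨a + c, b + d - a * c, by ring⟩

theorem pow_mem_powerSemigroup (k : ℕ) (x : R) : x ^ k ∈ powerSemigroup R k :=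
  AddSubsemigroup.subset_closure ⟨x, rfl⟩

theorem IsSumOfAtMostPowers.exists_sum_eq {k n : ℕ} (hk : k ≠ 0) {a : R}
    (h : IsSumOfAtMostPowers k n a) : ∃ x : Fin n → R, a = ∑ i, x i ^ k := by
  obtain ⟨m, hm, x, rfl⟩ := h
  obtain ⟨d, rfl⟩ := Nat.exists_eq_add_of_le hm
  exact ⟨Fin.append x 0, by simp [Fin.sum_univ_add, hk]⟩

/-- A sum of fewer powers can be padded with zeros, so it is enough to test sums of exactly `g + 1`
powers from above and sums of exactly `g` powers from below. -/
theorem isWaringNumber_succ {k g : ℕ} (hk : k ≠ 0)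
    (hub : ∀ a ∈ powerSemigroup R k, ∃ x : Fin (g + 1) → R, a = ∑ i, x i ^ k)
    {c : R} (hc : c ∈ powerSemigroup R k) (hlb : ∀ x : Fin g → R, c ≠ ∑ i, x i ^ k) :
    IsWaringNumber R k (g + 1) := by
  refine ⟨⟨g.succ_pos, fun a ha => ⟨g + 1, le_rfl, hub a ha⟩⟩, fun n ⟨_, hn⟩ => ?_⟩
  by_contra! hlt
  obtain ⟨m, hm, hx⟩ := hn c hc
  obtain ⟨x, hx⟩ := IsSumOfAtMostPowers.exists_sum_eq hk ⟨m, hm.trans (Nat.lt_succ_iff.mp hlt), hx⟩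
  exact hlb x hx

end Waring

theorem theorem3 (e : ℕ) (he : 1 ≤ e) :
    IsWaringNumber (PadicRootRing 2 e) 2 (if Odd e then 4 else 3) := by
  have h := isDyadicUniformizer_root he
  split_ifs with hodd
  · refine isWaringNumber_succ (g := 3) two_ne_zero (fun N hN => ?_) (c := -1) ?_ fun x => ?_
    · obtain ⟨a, b, rfl⟩ := exists_eq_sq_add_two_mul hN
      obtain ⟨x, y, z, w, hx⟩ := h.exists_four_sq hodd a b
      exact ⟨![x, y, z, w], by simp [hx, Fin.sum_univ_four]⟩
    · obtain ⟨x, y, z, w, hx⟩ := h.exists_four_sq hodd 1 (-1)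
      rw [show (-1 : PadicRootRing 2 e) = 1 ^ 2 + 2 * -1 by ring, hx]
      exact add_mem (add_mem (add_mem (pow_mem_powerSemigroup 2 x) (pow_mem_powerSemigroup 2 y))
        (pow_mem_powerSemigroup 2 z)) (pow_mem_powerSemigroup 2 w)
    · rw [Fin.sum_univ_three]
      exact neg_one_ne_sum_three_sq hodd _ _ _
  · have heven := Nat.not_odd_iff_even.mp hodd
    set π : PadicRootRing 2 e := AdjoinRoot.root _
    refine isWaringNumber_succ (g := 2) two_ne_zero (fun N hN => ?_) (c := 2 * (1 + π)) ?_
      fun x => ?_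
    · obtain ⟨a, b, rfl⟩ := exists_eq_sq_add_two_mul hN
      obtain ⟨x, y, z, hx⟩ := h.exists_three_sq heven a b
      exact ⟨![x, y, z], by simp [hx, Fin.sum_univ_three]⟩
    · obtain ⟨x, y, z, hx⟩ := h.exists_three_sq heven 0 (1 + π)
      rw [show 2 * (1 + π) = 0 ^ 2 + 2 * (1 + π) by ring, hx]
      exact add_mem (add_mem (pow_mem_powerSemigroup 2 x) (pow_mem_powerSemigroup 2 y))
        (pow_mem_powerSemigroup 2 z)
    · rw [Fin.sum_univ_two]
      exact h.two_mul_one_add_ne_sum_two_sq heven _ _
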